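/- A $\mathbb{Z}$-grading of a $C^*$-algebra $A$ is a family $(A_n)_{n\in\mathbb{Z}}$ of closed subspaces of $A$ such that $A_mA_n\subseteq A_{m+n}$ and $A_{-n}=A_n^*$ for all $m,n$ (so that $A_0$ is a $C^*$-subalgebra), $A=\overline{\operatorname{span}}\bigcup_n A_n$, and there is a positive norm-decreasing linear map $E:A\to A_0$ with $E|_{A_0}=\mathrm{id}$ and $E(A_n)=\{0\}$ for $n\neq 0$. It is strong if $\overline{\operatorname{span}}\,A_mA_n=A_{m+n}$ for all $m,n\in\mathbb{Z}$. A $C^*$-correspondence over a $C^*$-algebra $B$ is a right-Hilbert $B$-module $X$ with a left action of $B$ such that $\langle a\cdot x,y\rangle=\langle x,a^*\cdot y\rangle$; write $\phi_X(a)x=a\cdot x$. It is full if $\overline{\operatorname{span}}\,\langle X,X\rangle=B$; its left action is injective if $\phi_X$ is injective, and compact if $\phi_X(B)\subseteq\mathcal{K}(X)=\overline{\operatorname{span}}\{\theta_{x,y}:x,y\in X\}$, where $\theta_{x,y}(z)=x\cdot\langle y,z\rangle$. A representation of $X$ in a $C^*$-algebra $C$ is a pair $(\pi,\psi)$ of a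 $*$-homomorphism $\pi:B\to C$ and a linear map $\psi:X\to C$ with $\psi(a\cdot x)=\pi(a)\psi(x)$, $\psi(x\cdot a)=\psi(x)\pi(a)$ and $\pi(\langle x,y\rangle)=\psi(x)^*\psi(y)$. If $X$ has compact injective left action, then $(\pi,\psi)$ is covariant if $\pi^{(1)}(\phi_X(a))=\pi(a)$ for all $a\in B$, where $\pi^{(1)}:\mathcal{K}(X)\to C$ is the homomorphism with $\pi^{(1)}(\theta_{x,y})=\psi(x)\psi(y)^*$; and the Cuntz--Pimsner algebra $\mathcal{O}_X$ is the universal $C^*$-algebra generated by the image of a covariant representation $(j_B,j_X)$ of $X$. **Lemma.** Let $A$ be a strongly $\mathbb{Z}$-graded $C^*$-algebra with graded subspaces $A_n$, $n\in\mathbb{Z}$. Then $X:=A_1$, with left and right actions of $A_0$ given by multiplication in $A$ and with inner product $\langle x,y\rangle=x^*y$, is a full $C^*$-correspondence over $A_0$ with compact injective left action, and there is an isomorphism $\Psi:A\cong\mathcal{O}_X$ such that $\Psi|_{A_1}=j_X$ and $\Psi|_{A_0}=j_{A_0}$. -/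

import Mathlib

open scoped ENNReal

universe u v w

/-! ### Graded C*-algebras -/

/-- An `H`-grading of a C*-algebra `A` (with `H` written additively): closed subspaces `A_g` with
`A_g A_h ⊆ A_{g+h}` and `A_{-g} = A_g^*`, whose union has dense linear span, and which admit a
positive norm-decreasing linear map `E : A → A_0` that restricts to the identity on `A_0` and
vanishes on `A_g` for `g ≠ 0`. An element is positive when it is of the form `b^* b`. That `A_0` is
a C*-subalgebra follows from the other conditions, see `CStarGrading.zeroSubalgebra`. -/
structure CStarGrading (H : Type v) [AddGroup H] (A : Type u) [NonUnitalCStarAlgebra A] where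
  /-- the graded subspace `A_g` -/
  component : H → Submodule ℂ A
  isClosed_component : ∀ g, IsClosed (component g : Set A)
  mul_mem : ∀ {g h : H} {a b : A}, a ∈ component g → b ∈ component h → a * b ∈ component (g + h)
  mem_neg_iff : ∀ (g : H) (a : A), a ∈ component (-g) ↔ star a ∈ component g
  dense_span : (⨆ g, component g).topologicalClosure = ⊤
  exists_expectation : ∃ E : A →ₗ[ℂ] component 0,
    (∀ a, ∃ b : A, b ∈ component 0 ∧ (E (star a * a) : A) = star b * b) ∧
    (∀ a, ‖E a‖ ≤ ‖a‖) ∧ (∀ a : component 0, E (a : A) = a) ∧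
    ∀ g, g ≠ 0 → ∀ a ∈ component g, E a = 0

namespace CStarGrading

variable {H : Type v} [AddGroup H] {A : Type u} [NonUnitalCStarAlgebra A]

/-- A grading is strong if `A_{g+h}` is the closed linear span of `A_g A_h` for all `g, h`. -/
def IsStrong (G : CStarGrading H A) : Prop :=
  ∀ g h : H, (Submodule.span ℂ
    {c : A | ∃ a ∈ G.component g, ∃ b ∈ G.component h, a * b = c}).topologicalClosure =
      G.component (g + h)

/-- The C*-subalgebra `A_0` of a graded C*-algebra. -/
def zeroSubalgebra (G : CStarGrading H A) : NonUnitalStarSubalgebra ℂ A where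
  carrier := G.component 0
  add_mem' := (G.component 0).add_mem
  zero_mem' := (G.component 0).zero_mem
  smul_mem' := fun c _ hx => (G.component 0).smul_mem c hx
  mul_mem' := fun ha hb => by simpa using G.mul_mem ha hb
  star_mem' := fun {a} ha => (G.mem_neg_iff 0 a).1 (by simpa using ha)

instance (G : CStarGrading H A) : IsClosed (G.zeroSubalgebra : Set A) :=
  G.isClosed_component 0

end CStarGrading

/-! ### Hilbert modules and C*-correspondences -/

/-- A right-Hilbert module over the C*-algebra `B`, structured on a complex normed space `X`: a
right `B`-module with a `B`-valued inner product that is linear in the second variable, such that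
`X` is complete in the norm `‖x‖ = ‖⟨x, x⟩‖ ^ (1/2)`. -/
structure RightHilbertModule (B : Type v) [NonUnitalCStarAlgebra B]
    (X : Type w) [NormedAddCommGroup X] [NormedSpace ℂ X] where
  /-- the right action, `ract x b = x · b` -/
  ract : X →ₗ[ℂ] B →ₗ[ℂ] X
  ract_mul : ∀ x a b, ract x (a * b) = ract (ract x a) b
  /-- the inner product `⟨x, y⟩_B`, as a linear map in `y` -/
  inner : X → X →ₗ[ℂ] B
  inner_ract : ∀ x y b, inner x (ract y b) = inner x y * b
  star_inner : ∀ x y, star (inner x y) = inner y x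
  inner_self_nonneg : ∀ x, ∃ b, inner x x = star b * b
  inner_self_eq_zero : ∀ x, inner x x = 0 → x = 0
  norm_sq_eq : ∀ x, ‖x‖ ^ 2 = ‖inner x x‖
  complete : CompleteSpace X

/-- A C*-correspondence over `B`: a right-Hilbert `B`-module with a left action of `B` such that
`⟨a · x, y⟩ = ⟨x, a^* · y⟩`. -/
structure CStarCorrespondence (B : Type v) [NonUnitalCStarAlgebra B]
    (X : Type w) [NormedAddCommGroup X] [NormedSpace ℂ X] extends RightHilbertModule B X where
  /-- the left action, `lact a x = a · x` -/
  lact : B →ₗ[ℂ] X →ₗ[ℂ] X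
  lact_mul : ∀ a b x, lact (a * b) x = lact a (lact b x)
  inner_lact : ∀ a x y, inner (lact a x) y = inner x (lact (star a) y)

namespace RightHilbertModule

variable {B : Type v} [NonUnitalCStarAlgebra B]
  {X : Type w} [NormedAddCommGroup X] [NormedSpace ℂ X] (M : RightHilbertModule B X)

/-- `X` is full if the inner products densely span `B`. -/
def IsFull : Prop :=
  (Submodule.span ℂ {b : B | ∃ x y, M.inner x y = b}).topologicalClosure = ⊤

/-- The Cauchy-Schwarz inequality. -/
theorem norm_inner_le (x y : X) : ‖M.inner x y‖ ≤ ‖x‖ * ‖y‖ := by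
  let _ := CStarAlgebra.spectralOrder Bᵐᵒᵖ
  have _ := CStarAlgebra.spectralOrderedRing Bᵐᵒᵖ
  let _ : SMul Bᵐᵒᵖ X := ⟨fun b x => M.ract x b.unop⟩
  let _ : CStarModule Bᵐᵒᵖ X :=
    { inner := fun x y => MulOpposite.op (M.inner x y)
      inner_add_right := by intros; simp
      inner_self_nonneg := by
        intro x
        obtain ⟨b, hb⟩ := M.inner_self_nonneg x
        rw [hb, MulOpposite.op_mul, MulOpposite.op_star]
        exact mul_star_self_nonneg _
      inner_self := by
        intro x
        refine ⟨fun h => M.inner_self_eq_zero x (MulOpposite.op_injective h), ?_⟩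
        rintro rfl
        simp
      inner_op_smul_right := by
        intro a x y
        change MulOpposite.op (M.inner x (M.ract y a.unop)) = _
        rw [M.inner_ract]
        simp
      inner_smul_right_complex := by intros; simp
      star_inner := by
        intro x y
        rw [← MulOpposite.op_star, M.star_inner]
      norm_eq_sqrt_norm_inner_self := by
        intro x
        change ‖x‖ = √‖M.inner x x‖
        rw [← M.norm_sq_eq, Real.sqrt_sq (norm_nonneg x)] }
  exact CStarModule.norm_inner_le (A := Bᵐᵒᵖ) X (x := x) (y := y)

theorem ext_inner {x y : X} (h : ∀ z, M.inner z x = M.inner z y) : x = y := by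
  refine sub_eq_zero.1 (M.inner_self_eq_zero _ ?_)
  rw [map_sub, h, sub_self]

/-- An adjointable operator is bounded. -/
theorem continuous_of_adjoint (T : X →ₗ[ℂ] X) (S : X → X)
    (h : ∀ x y, M.inner (T x) y = M.inner x (S y)) : Continuous T := by
  have _ := M.complete
  have hc : ∀ z, Continuous (M.inner z) := fun z =>
    AddMonoidHomClass.continuous_of_bound (M.inner z) ‖z‖ (M.norm_inner_le z)
  have h' : ∀ x y, M.inner x (T y) = M.inner (S x) y := fun x y => by
    rw [← M.star_inner, h, M.star_inner]
  refine T.continuous_of_seq_closed_graph fun s x y hs hTs => M.ext_inner fun z => ?_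
  have h1 := ((hc z).tendsto y).comp hTs
  have h2 := ((hc (S z)).tendsto x).comp hs
  rw [h']
  refine tendsto_nhds_unique h1 (h2.congr fun n => ?_)
  simp [h']

/-- The operator `θ_{x,y} : z ↦ x · ⟨y, z⟩`, with adjoint `θ_{y,x}`. -/
noncomputable def theta (x y : X) : X →L[ℂ] X where
  toLinearMap := (M.ract x).comp (M.inner y)
  cont := M.continuous_of_adjoint _ (fun z => M.ract y (M.inner x z)) fun a b => by
    rw [← M.star_inner, LinearMap.comp_apply, M.inner_ract, M.inner_ract, star_mul, M.star_inner,
      M.star_inner]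

@[simp]
theorem theta_apply (x y z : X) : M.theta x y z = M.ract x (M.inner y z) := rfl

/-- The space `K(X)` of compact operators: the operator-norm closed span of the `θ_{x,y}`. -/
noncomputable def compacts : Submodule ℂ (X →L[ℂ] X) :=
  (Submodule.span ℂ {T | ∃ x y, M.theta x y = T}).topologicalClosure

theorem theta_mem (x y : X) : M.theta x y ∈ M.compacts :=
  Submodule.le_topologicalClosure _ (Submodule.subset_span ⟨x, y, rfl⟩)

/-- The operator `θ_{x,y}`, as an element of `K(X)`. -/
noncomputable def thetaK (x y : X) : M.compacts := ⟨M.theta x y, M.theta_mem x y⟩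

/-- The linear span of the `θ_{x,y}` in `K(X)`. -/
noncomputable def finiteRank : Submodule ℂ M.compacts :=
  Submodule.span ℂ {T | ∃ x y, M.thetaK x y = T}

theorem dense_finiteRank : Dense (M.finiteRank : Set M.compacts) := by
  intro T
  rw [closure_subtype]
  have h : (Subtype.val '' (M.finiteRank : Set M.compacts) : Set (X →L[ℂ] X)) =
      (Submodule.span ℂ {T | ∃ x y, M.theta x y = T} : Set (X →L[ℂ] X)) := by
    have h2 : M.finiteRank.map M.compacts.subtype =
        Submodule.span ℂ {T | ∃ x y, M.theta x y = T} := by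
      rw [finiteRank, Submodule.map_span]
      congr 1
      ext S
      constructor
      · rintro ⟨_, ⟨x, y, rfl⟩, rfl⟩
        exact ⟨x, y, rfl⟩
      · rintro ⟨x, y, rfl⟩
        exact ⟨_, ⟨x, y, rfl⟩, rfl⟩
    rw [← h2]
    rfl
  rw [h]
  exact T.2

end RightHilbertModule

namespace CStarCorrespondence

variable {B : Type v} [NonUnitalCStarAlgebra B]
  {X : Type w} [NormedAddCommGroup X] [NormedSpace ℂ X] (M : CStarCorrespondence B X)

/-- The operator `φ_X(a) : x ↦ a · x`. -/
noncomputable def phi (a : B) : X →L[ℂ] X where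
  toLinearMap := M.lact a
  cont := M.continuous_of_adjoint _ (M.lact (star a)) (M.inner_lact a)

@[simp]
theorem phi_apply (a : B) (x : X) : M.phi a x = M.lact a x := rfl

/-- `φ_X` is injective. -/
def HasInjectiveLeftAction : Prop := Function.Injective M.phi

/-- `φ_X` takes values in the compact operators. -/
def HasCompactLeftAction : Prop := ∀ a, M.phi a ∈ M.compacts

/-- A representation `(π, ψ)` of the correspondence `X` in a C*-algebra `C`. -/
structure Representation (C : Type*) [NonUnitalCStarAlgebra C] where
  /-- the homomorphism on the coefficient algebra -/
  π : B →⋆ₙₐ[ℂ] C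
  /-- the linear map on the module -/
  ψ : X →ₗ[ℂ] C
  map_lact : ∀ a x, ψ (M.lact a x) = π a * ψ x
  map_ract : ∀ x a, ψ (M.ract x a) = ψ x * π a
  map_inner : ∀ x y, π (M.inner x y) = star (ψ x) * ψ y

variable {M}

/-- Covariance of a representation: `π⁽¹⁾(φ_X(a)) = π(a)`, where `π⁽¹⁾ : K(X) → C` is the map
with `π⁽¹⁾(θ_{x,y}) = ψ(x) ψ(y)^*`. As the `θ_{x,y}` span a dense subspace of `K(X)`, there is at
most one bounded linear map `σ` with these values, and it is automatically a homomorphism of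
C*-algebras. If `X` has compact left action, then the condition concerns every `a` in `B`. -/
def Representation.IsCovariant {C : Type*} [NonUnitalCStarAlgebra C]
    (ρ : M.Representation C) : Prop :=
  ∃ σ : M.compacts →ₗ[ℂ] C, (∃ c : ℝ, ∀ T, ‖σ T‖ ≤ c * ‖T‖) ∧
    (∀ x y, σ (M.thetaK x y) = ρ.ψ x * star (ρ.ψ y)) ∧
    ∀ (a : B) (h : M.phi a ∈ M.compacts), σ ⟨M.phi a, h⟩ = ρ.π a

theorem Representation.norm_psi_le {C : Type*} [NonUnitalCStarAlgebra C]
    (ρ : M.Representation C) (x : X) : ‖ρ.ψ x‖ ≤ ‖x‖ := by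
  refine le_of_sq_le_sq ?_ (norm_nonneg x)
  rw [M.norm_sq_eq, sq, ← CStarRing.norm_star_mul_self, ← ρ.map_inner]
  exact NonUnitalStarAlgHom.norm_apply_le ρ.π _

/-- A linear map with the values `σ(θ_{x,y}) = ψ(x) ψ(y)^*` is multiplicative on the span of
the `θ_{x,y}`. -/
theorem Representation.exists_mul {C : Type*} [NonUnitalCStarAlgebra C]
    (ρ : M.Representation C) (σ : M.compacts →ₗ[ℂ] C)
    (hσ : ∀ x y, σ (M.thetaK x y) = ρ.ψ x * star (ρ.ψ y)) {S T : M.compacts}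
    (hS : S ∈ M.finiteRank) (hT : T ∈ M.finiteRank) :
    ∃ R ∈ M.finiteRank, (R : X →L[ℂ] X) = (S : X →L[ℂ] X).comp (T : X →L[ℂ] X) ∧
      σ R = σ S * σ T := by
  induction hS using Submodule.span_induction with
  | mem S hS =>
    obtain ⟨x, y, rfl⟩ := hS
    induction hT using Submodule.span_induction with
    | mem T hT =>
      obtain ⟨z, w, rfl⟩ := hT
      refine ⟨M.thetaK (M.ract x (M.inner y z)) w, Submodule.subset_span ⟨_, _, rfl⟩, ?_, ?_⟩
      · ext v
        simp [RightHilbertModule.thetaK, M.inner_ract, M.ract_mul]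
      · simp only [hσ, ρ.map_ract, ρ.map_inner, mul_assoc]
    | zero => exact ⟨0, Submodule.zero_mem _, by simp, by simp⟩
    | add T T' _ _ h h' =>
      obtain ⟨R, hR, h1, h2⟩ := h
      obtain ⟨R', hR', h1', h2'⟩ := h'
      exact ⟨R + R', Submodule.add_mem _ hR hR', by simp [h1, h1', ContinuousLinearMap.comp_add],
        by simp [h2, h2', mul_add]⟩
    | smul c T _ h =>
      obtain ⟨R, hR, h1, h2⟩ := h
      exact ⟨c • R, Submodule.smul_mem _ c hR, by simp [h1], by simp [h2, mul_smul_comm]⟩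
  | zero => exact ⟨0, Submodule.zero_mem _, by simp, by simp⟩
  | add T T' _ _ h h' =>
    obtain ⟨R, hR, h1, h2⟩ := h
    obtain ⟨R', hR', h1', h2'⟩ := h'
    exact ⟨R + R', Submodule.add_mem _ hR hR', by simp [h1, h1', ContinuousLinearMap.add_comp],
      by simp [h2, h2', add_mul]⟩
  | smul c T _ h =>
    obtain ⟨R, hR, h1, h2⟩ := h
    exact ⟨c • R, Submodule.smul_mem _ c hR, by simp [h1], by simp [h2, smul_mul_assoc]⟩

theorem Representation.exists_star {C : Type*} [NonUnitalCStarAlgebra C]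
    (ρ : M.Representation C) (σ : M.compacts →ₗ[ℂ] C)
    (hσ : ∀ x y, σ (M.thetaK x y) = ρ.ψ x * star (ρ.ψ y)) {S : M.compacts}
    (hS : S ∈ M.finiteRank) :
    ∃ R ∈ M.finiteRank, (∀ x y, M.inner ((S : X →L[ℂ] X) x) y = M.inner x ((R : X →L[ℂ] X) y)) ∧
      σ R = star (σ S) := by
  have add_left : ∀ x y z, M.inner (x + y) z = M.inner x z + M.inner y z := fun x y z => by
    rw [← M.star_inner, map_add, star_add, M.star_inner, M.star_inner]
  have smul_left : ∀ (c : ℂ) x z, M.inner (c • x) z = star c • M.inner x z := fun c x z => by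
    rw [← M.star_inner, map_smul, star_smul, M.star_inner]
  induction hS using Submodule.span_induction with
  | mem S hS =>
    obtain ⟨x, y, rfl⟩ := hS
    refine ⟨M.thetaK y x, Submodule.subset_span ⟨_, _, rfl⟩, fun a b => ?_, ?_⟩
    · simp only [RightHilbertModule.thetaK, RightHilbertModule.theta_apply, M.inner_ract]
      rw [← M.star_inner, M.inner_ract, star_mul, M.star_inner, M.star_inner]
    · simp only [hσ, star_mul, star_star]
  | zero =>
    refine ⟨0, Submodule.zero_mem _, fun x y => ?_, by simp⟩
    rw [← M.star_inner]
    simp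
  | add T T' _ _ h h' =>
    obtain ⟨R, hR, h1, h2⟩ := h
    obtain ⟨R', hR', h1', h2'⟩ := h'
    exact ⟨R + R', Submodule.add_mem _ hR hR', by simp [add_left, h1, h1'], by simp [h2, h2']⟩
  | smul c T _ h =>
    obtain ⟨R, hR, h1, h2⟩ := h
    exact ⟨star c • R, Submodule.smul_mem _ _ hR, by simp [smul_left, h1], by simp [h2]⟩

theorem Representation.norm_le_of_symm {C : Type*} [NonUnitalCStarAlgebra C]
    (ρ : M.Representation C) (σ : M.compacts →ₗ[ℂ] C)
    (hσ : ∀ x y, σ (M.thetaK x y) = ρ.ψ x * star (ρ.ψ y)) {c : ℝ}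
    (hc : ∀ T, ‖σ T‖ ≤ c * ‖T‖) (n : ℕ) :
    ∀ S ∈ M.finiteRank, star (σ S) = σ S → ‖σ S‖ ^ 2 ^ n ≤ |c| * ‖S‖ ^ 2 ^ n := by
  induction n with
  | zero => 
    intro S _ _
    simpa using (hc S).trans (mul_le_mul_of_nonneg_right (le_abs_self c) (norm_nonneg S))
  | succ n ih =>
    intro S hS hs
    obtain ⟨R, hR, h1, h2⟩ := ρ.exists_mul σ hσ hS hS
    have e : ‖σ S‖ ^ 2 = ‖σ R‖ := by
      rw [h2, sq, ← CStarRing.norm_star_mul_self, hs]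
    have hRS : ‖R‖ ≤ ‖S‖ ^ 2 := by
      change ‖(R : X →L[ℂ] X)‖ ≤ ‖(S : X →L[ℂ] X)‖ ^ 2
      rw [h1, sq]
      exact ContinuousLinearMap.opNorm_comp_le _ _
    rw [pow_succ', pow_mul, pow_mul, e]
    refine (ih R hR (by rw [h2, star_mul, hs])).trans ?_
    gcongr

/-- The map `π⁽¹⁾` is norm-decreasing. -/
theorem Representation.norm_le {C : Type*} [NonUnitalCStarAlgebra C]
    (ρ : M.Representation C) (σ : M.compacts →ₗ[ℂ] C)
    (hσ : ∀ x y, σ (M.thetaK x y) = ρ.ψ x * star (ρ.ψ y))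
    (hσ' : ∃ c : ℝ, ∀ T, ‖σ T‖ ≤ c * ‖T‖) (T : M.compacts) : ‖σ T‖ ≤ ‖T‖ := by
  obtain ⟨c, hc⟩ := hσ'
  have key : ∀ S ∈ M.finiteRank, star (σ S) = σ S → ‖σ S‖ ≤ ‖S‖ := by
    intro S hS hs
    by_contra! hlt
    have h := fun n => ρ.norm_le_of_symm σ hσ hc n S hS hs
    rcases (norm_nonneg S).eq_or_lt with h0 | h0
    · have hS0 : S = 0 := norm_eq_zero.1 h0.symm
      simp [hS0] at hlt
    · obtain ⟨n, hn⟩ := pow_unbounded_of_one_lt |c| ((one_lt_div h0).2 hlt)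
      have h2 : (‖σ S‖ / ‖S‖) ^ n ≤ (‖σ S‖ / ‖S‖) ^ 2 ^ n :=
        pow_le_pow_right₀ ((one_lt_div h0).2 hlt).le Nat.lt_two_pow_self.le
      have h3 : (‖σ S‖ / ‖S‖) ^ 2 ^ n ≤ |c| := by
        rw [div_pow, div_le_iff₀ (by positivity)]
        exact h n
      linarith
  have key2 : ∀ S ∈ M.finiteRank, ‖σ S‖ ≤ ‖S‖ := by
    intro S hS
    obtain ⟨S', hS', h1, h2⟩ := ρ.exists_star σ hσ hS
    obtain ⟨R, hR, h3, h4⟩ := ρ.exists_mul σ hσ hS' hS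
    have hn : ‖S'‖ ≤ ‖S‖ := by
      refine ContinuousLinearMap.opNorm_le_bound _ (norm_nonneg _) fun x => ?_
      change ‖(S' : X →L[ℂ] X) x‖ ≤ ‖(S : X →L[ℂ] X)‖ * ‖x‖
      rcases (norm_nonneg ((S' : X →L[ℂ] X) x)).eq_or_lt with h0 | h0
      · rw [← h0]; positivity
      · refine le_of_mul_le_mul_right ?_ h0
        rw [← sq, M.norm_sq_eq, ← h1]
        refine (M.norm_inner_le _ _).trans ?_
        have := (S : X →L[ℂ] X).le_opNorm ((S' : X →L[ℂ] X) x)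
        calc _ ≤ ‖(S : X →L[ℂ] X)‖ * ‖(S' : X →L[ℂ] X) x‖ * ‖x‖ := by gcongr
          _ = _ := by ring
    have hR2 : ‖R‖ ≤ ‖S‖ ^ 2 := by
      change ‖(R : X →L[ℂ] X)‖ ≤ ‖(S : X →L[ℂ] X)‖ ^ 2
      rw [h3, sq]
      refine (ContinuousLinearMap.opNorm_comp_le _ _).trans ?_
      exact mul_le_mul_of_nonneg_right hn (norm_nonneg _)
    refine le_of_sq_le_sq ?_ (norm_nonneg _)
    rw [sq, ← CStarRing.norm_star_mul_self, ← h2, ← h4]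
    exact (key R hR (by rw [h4, h2, star_mul, star_star])).trans hR2
  have hd : T ∈ closure (M.finiteRank : Set M.compacts) := M.dense_finiteRank T
  have hcont : Continuous σ := AddMonoidHomClass.continuous_of_bound σ c hc
  exact closure_minimal (t := {S : M.compacts | ‖σ S‖ ≤ ‖S‖}) key2
    (isClosed_le hcont.norm continuous_norm) hd

end CStarCorrespondence

/-! ### Cuntz-Pimsner algebras -/

namespace CStarCorrespondence

variable {B : Type u} [NonUnitalCStarAlgebra B]
  {X : Type u} [NormedAddCommGroup X] [NormedSpace ℂ X] (M : CStarCorrespondence B X)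

/-- A covariant representation of `X` in some C*-algebra. -/
structure CovariantRep where
  /-- the C*-algebra -/
  carrier : Type u
  [str : NonUnitalCStarAlgebra carrier]
  /-- the representation -/
  rep : M.Representation carrier
  covariant : rep.IsCovariant

instance (ρ : M.CovariantRep) : NonUnitalCStarAlgebra ρ.carrier := ρ.str

/-- The C*-algebra of bounded families indexed by all covariant representations of `X`. -/
abbrev BoundedFamilies : Type (u + 1) := lp (fun ρ : M.CovariantRep => ρ.carrier) ∞

/-- The family `(π(a))` indexed by all covariant representations `(π, ψ)`. -/
noncomputable def familyA (a : B) : M.BoundedFamilies :=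
  ⟨fun ρ => ρ.rep.π a, memℓp_infty ⟨‖a‖, by
    rintro _ ⟨ρ, rfl⟩
    exact NonUnitalStarAlgHom.norm_apply_le ρ.rep.π a⟩⟩

/-- The family `(ψ(x))` indexed by all covariant representations `(π, ψ)`. -/
noncomputable def familyX (x : X) : M.BoundedFamilies :=
  ⟨fun ρ => ρ.rep.ψ x, memℓp_infty ⟨‖x‖, by
    rintro _ ⟨ρ, rfl⟩
    exact ρ.rep.norm_psi_le x⟩⟩

/-- The Cuntz-Pimsner algebra `O_X` of a regular (compact and injective left action)
C*-correspondence, as a C*-subalgebra of the product of all its covariant representations: the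
universal C*-algebra generated by a covariant representation. See `cuntzPimsner_universal` for the
universal property. The representations range over the C*-algebras in the universe of `B` and `X`;
this is no restriction, as the C*-algebra generated by a representation in any universe has a copy
in that universe. -/
noncomputable def cuntzPimsner : NonUnitalStarSubalgebra ℂ M.BoundedFamilies :=
  (NonUnitalStarAlgebra.adjoin ℂ
    (Set.range M.familyA ∪ Set.range M.familyX)).topologicalClosure

instance : IsClosed (M.cuntzPimsner : Set M.BoundedFamilies) :=
  NonUnitalStarSubalgebra.isClosed_topologicalClosure _

/-- The underlying C*-algebra of `O_X`. -/
abbrev CuntzPimsner : Type (u + 1) := M.cuntzPimsner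

/-- The canonical representation `(j_A, j_X)` of `X` in `O_X`. -/
noncomputable def canonicalRep : M.Representation M.CuntzPimsner where
  π :=
    { toFun := fun a => ⟨M.familyA a, NonUnitalStarSubalgebra.le_topologicalClosure _
        (NonUnitalStarAlgebra.subset_adjoin ℂ _ (Or.inl ⟨a, rfl⟩))⟩
      map_smul' := fun c a => by ext ρ; exact map_smul ρ.rep.π c a
      map_zero' := by ext ρ; exact map_zero ρ.rep.π
      map_add' := fun a b => by ext ρ; exact map_add ρ.rep.π a b
      map_mul' := fun a b => by ext ρ; exact map_mul ρ.rep.π a b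
      map_star' := fun a => by ext ρ; exact map_star ρ.rep.π a }
  ψ :=
    { toFun := fun x => ⟨M.familyX x, NonUnitalStarSubalgebra.le_topologicalClosure _
        (NonUnitalStarAlgebra.subset_adjoin ℂ _ (Or.inr ⟨x, rfl⟩))⟩
      map_add' := fun x y => by ext ρ; exact map_add ρ.rep.ψ x y
      map_smul' := fun c x => by ext ρ; exact map_smul ρ.rep.ψ c x }
  map_lact := fun a x => by ext ρ; exact ρ.rep.map_lact a x
  map_ract := fun x a => by ext ρ; exact ρ.rep.map_ract x a
  map_inner := fun x y => by ext ρ; exact ρ.rep.map_inner x y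

/-- The canonical homomorphism `j_A` of the coefficient algebra into `O_X`. -/
noncomputable abbrev jA : B →⋆ₙₐ[ℂ] M.CuntzPimsner := M.canonicalRep.π

/-- The canonical linear map `j_X` of the module into `O_X`. -/
noncomputable abbrev jX : X →ₗ[ℂ] M.CuntzPimsner := M.canonicalRep.ψ

/-- The pair `(j_A, j_X)` is covariant. -/
theorem canonicalRep_isCovariant : M.canonicalRep.IsCovariant := by
  choose s hb' hs hs' using fun ρ : M.CovariantRep => ρ.covariant
  have hb := fun ρ : M.CovariantRep => ρ.rep.norm_le (s ρ) (hs ρ) (hb' ρ)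
  let τ : M.compacts →ₗ[ℂ] M.BoundedFamilies :=
    { toFun := fun T => ⟨fun ρ => s ρ T, memℓp_infty ⟨‖T‖, by
        rintro _ ⟨ρ, rfl⟩
        exact hb ρ T⟩⟩
      map_add' := fun S T => by ext ρ; exact map_add (s ρ) S T
      map_smul' := fun c T => by ext ρ; exact map_smul (s ρ) c T }
  have hτ : ∀ T, ‖τ T‖ ≤ 1 * ‖T‖ := fun T => by
    rw [one_mul]
    exact lp.norm_le_of_forall_le (norm_nonneg T) fun ρ => hb ρ T
  have hcont : Continuous τ := AddMonoidHomClass.continuous_of_bound τ 1 hτ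
  have hθ : ∀ x y, τ (M.thetaK x y) = M.jX x * star (M.jX y) := fun x y => by
    ext ρ
    exact hs ρ x y
  have hmem : ∀ T, τ T ∈ M.cuntzPimsner := by
    intro T
    have hd : T ∈ closure (M.finiteRank : Set M.compacts) := M.dense_finiteRank T
    refine closure_minimal (t := τ ⁻¹' (M.cuntzPimsner : Set M.BoundedFamilies)) ?_ ?_ hd
    · intro S hS
      induction hS using Submodule.span_induction with
      | mem S hS =>
        obtain ⟨x, y, rfl⟩ := hS
        rw [Set.mem_preimage, hθ]
        exact (M.jX x * star (M.jX y)).2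
      | zero => simp
      | add S T _ _ h h' =>
        rw [Set.mem_preimage, map_add]
        exact add_mem h h'
      | smul c S _ h =>
        rw [Set.mem_preimage, map_smul]
        exact SMulMemClass.smul_mem c h
    · exact IsClosed.preimage hcont (NonUnitalStarSubalgebra.isClosed_topologicalClosure _)
  refine ⟨⟨⟨fun T => ⟨τ T, hmem T⟩, fun S T => Subtype.ext (map_add τ S T)⟩,
    fun c T => Subtype.ext (map_smul τ c T)⟩, ⟨1, hτ⟩, ?_, ?_⟩
  · exact fun x y => Subtype.ext (hθ x y)
  · intro a h
    refine Subtype.ext ?_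
    ext ρ
    exact hs' ρ a h

/-- The universal property of `O_X`: every covariant representation `(π, ψ)` factors through
`(j_A, j_X)` by a unique homomorphism. -/
theorem cuntzPimsner_universal {C : Type u} [NonUnitalCStarAlgebra C] (ρ : M.Representation C)
    (hρ : ρ.IsCovariant) :
    ∃! F : M.CuntzPimsner →⋆ₙₐ[ℂ] C, (∀ a, F (M.jA a) = ρ.π a) ∧ ∀ x, F (M.jX x) = ρ.ψ x := by
  let i : M.CovariantRep := ⟨C, ρ, hρ⟩
  let F : M.CuntzPimsner →⋆ₙₐ[ℂ] C :=
    { toFun := fun f => (f : M.BoundedFamilies) i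
      map_smul' := fun _ _ => rfl
      map_zero' := rfl
      map_add' := fun _ _ => rfl
      map_mul' := fun _ _ => rfl
      map_star' := fun _ => rfl }
  refine ⟨F, ⟨fun _ => rfl, fun _ => rfl⟩, ?_⟩
  rintro F' ⟨hA, hX⟩
  have hc : ∀ F : M.CuntzPimsner →⋆ₙₐ[ℂ] C, Continuous F := fun F =>
    AddMonoidHomClass.continuous_of_bound F 1 fun a => by
      simpa using NonUnitalStarAlgHom.norm_apply_le F a
  have hclosed : IsClosed {f : M.CuntzPimsner | F' f = F f} := isClosed_eq (hc F') (hc F)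
  ext f
  have hf : (f : M.BoundedFamilies) ∈ closure (NonUnitalStarAlgebra.adjoin ℂ
    (Set.range M.familyA ∪ Set.range M.familyX) : Set M.BoundedFamilies) := f.2
  have hle := NonUnitalStarSubalgebra.le_topologicalClosure
    (NonUnitalStarAlgebra.adjoin ℂ (Set.range M.familyA ∪ Set.range M.familyX))
  have hadj : ∀ g (hg : g ∈ NonUnitalStarAlgebra.adjoin ℂ
      (Set.range M.familyA ∪ Set.range M.familyX)), F' ⟨g, hle hg⟩ = F ⟨g, hle hg⟩ := by
    intro g hg
    induction hg using NonUnitalStarAlgebra.adjoin_induction with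
    | mem g hg =>
      rcases hg with ⟨a, rfl⟩ | ⟨x, rfl⟩
      · exact hA a
      · exact hX x
    | zero => exact (map_zero F').trans (map_zero F).symm
    | add g h hg hh h1 h2 =>
      exact (map_add F' ⟨g, hle hg⟩ ⟨h, hle hh⟩).trans
        ((congrArg₂ (· + ·) h1 h2).trans (map_add F ⟨g, hle hg⟩ ⟨h, hle hh⟩).symm)
    | mul g h hg hh h1 h2 =>
      exact (map_mul F' ⟨g, hle hg⟩ ⟨h, hle hh⟩).trans
        ((congrArg₂ (· * ·) h1 h2).trans (map_mul F ⟨g, hle hg⟩ ⟨h, hle hh⟩).symm)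
    | smul c g hg h1 =>
      exact (map_smul F' c ⟨g, hle hg⟩).trans
        ((congrArg (c • ·) h1).trans (map_smul F c ⟨g, hle hg⟩).symm)
    | star g hg h1 =>
      exact (map_star F' ⟨g, hle hg⟩).trans
        ((congrArg star h1).trans (map_star F ⟨g, hle hg⟩).symm)
  have hf' : f ∈ closure {f : M.CuntzPimsner | F' f = F f} := by
    rw [closure_subtype]
    refine closure_mono (fun g hg => ?_) hf
    exact ⟨⟨g, hle hg⟩, hadj g hg, rfl⟩
  rwa [hclosed.closure_eq] at hf'

end CStarCorrespondence

/-! ### The correspondence of a graded C*-algebra -/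

namespace CStarGrading

variable {A : Type u} [NonUnitalCStarAlgebra A] (G : CStarGrading ℤ A)

/-! Everything about `X = A_1` comes from the density of the span of `A_{-1} A_1` and of `A_1
A_{-1}` in `A_0`. The first gives fullness. The second gives compactness, since `φ(xy^*) = θ_{x,y}`,
and shows that `φ` is isometric (`IsStrong.norm_phi`). Hence `φ(A_0)` is closed and contains `K(X)`,
so `φ⁻¹` is defined on `K(X)`, and composing it with `A_0 ⊆ A` shows that the inclusions of `A_0`
and `A_1` form a covariant representation. Evaluating there gives a homomorphism from `O_X` to `A`;
its inverse is the required `Ψ`.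

Injectivity is a gauge-invariant uniqueness argument in which the expectation `E` takes the place of
a circle action on `A`. As each `θ_{x,y}` is some `φ(a)`, covariance turns `j_X(x) j_X(y)^*` into a
coefficient, so the generated *-algebra is spanned by reduced words, and those of degree 0 are
coefficients. By the C*-identity the map to `A` is isometric in each degree, while `E` bounds each
component of a finite sum in `A` by the sum (`norm_component_le`). So the image in `A` controls
every homogeneous part of a word sum (`IsStrong.boundsDegrees`). If `f` in `O_X` maps to 0, then for
any covariant `(π, ψ)` and any functional `l` the function taking `z` to `l` of the value of `f` at
`(π, zψ)` is continuous with zero Fourier coefficients. It therefore vanishes, in particular at `z =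
1` (`eq_zero_of_eval_eq_zero`).

For surjectivity, the range is closed, as an injective *-homomorphism is isometric; it contains
`A_0` and `A_1`, and strength propagates this to all `A_n`. -/

theorem star_mem {n : ℤ} {a : A} (ha : a ∈ G.component n) : star a ∈ G.component (-n) :=
  (G.mem_neg_iff n (star a)).2 (by rwa [star_star])

theorem mul_mem_of_eq {m n k : ℤ} (h : m + n = k) {a b : A} (ha : a ∈ G.component m)
    (hb : b ∈ G.component n) : a * b ∈ G.component k :=
  h ▸ G.mul_mem ha hb

/-- A homogeneous component of a finite sum is bounded in norm by the sum. -/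
theorem norm_component_le (s : Finset ℤ) (a : ℤ → A) (ha : ∀ n, a n ∈ G.component n)
    {n : ℤ} (hn : n ∈ s) : ‖a n‖ ≤ ‖∑ m ∈ s, a m‖ := by
  obtain ⟨E, -, hE, hE0, hE1⟩ := G.exists_expectation
  have h0 : a n * star (a n) ∈ G.component 0 :=
    G.mul_mem_of_eq (add_neg_cancel n) (ha n) (G.star_mem (ha n))
  -- Multiplication by `a_n^*` moves the `n`-th term to degree 0 and every other term to degree `m -
  -- n ≠ 0`, so `E` isolates `a_n a_n^*`.
  have h : E ((∑ m ∈ s, a m) * star (a n)) = ⟨a n * star (a n), h0⟩ := by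
    rw [Finset.sum_mul, map_sum, Finset.sum_eq_single_of_mem n hn]
    · exact hE0 ⟨_, h0⟩
    · intro m _ hmn
      exact hE1 (m + -n) (by omega) _ (G.mul_mem (ha m) (G.star_mem (ha n)))
  have h1 := hE ((∑ m ∈ s, a m) * star (a n))
  rw [h] at h1
  change ‖a n * star (a n)‖ ≤ _ at h1
  rw [CStarRing.norm_self_mul_star] at h1
  rcases (norm_nonneg (a n)).eq_or_lt with h2 | h2
  · rw [← h2]
    exact norm_nonneg _
  · refine le_of_mul_le_mul_right (h1.trans ?_) h2
    simpa using norm_mul_le (∑ m ∈ s, a m) (star (a n))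

/-- The subspace `A_1` of a `ℤ`-graded C*-algebra, as a C*-correspondence over `A_0`. -/
noncomputable def correspondence : CStarCorrespondence G.zeroSubalgebra (G.component 1) where
  ract := LinearMap.mk₂ ℂ
    (fun x b => ⟨(x : A) * (b : A), G.mul_mem_of_eq (add_zero 1) x.2 b.2⟩)
    (fun x y b => Subtype.ext (add_mul (x : A) y b))
    (fun c x b => Subtype.ext (smul_mul_assoc c (x : A) (b : A)))
    (fun x a b => Subtype.ext (mul_add (x : A) a b))
    (fun c x b => Subtype.ext (mul_smul_comm c (x : A) (b : A)))
  ract_mul x a b := Subtype.ext (mul_assoc (x : A) a b).symm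
  inner x :=
    { toFun := fun y => ⟨star (x : A) * (y : A),
        G.mul_mem_of_eq (neg_add_cancel 1) (G.star_mem x.2) y.2⟩
      map_add' := fun y z => Subtype.ext (mul_add (star (x : A)) y z)
      map_smul' := fun c y => Subtype.ext (mul_smul_comm c (star (x : A)) (y : A)) }
  inner_ract x y b := Subtype.ext (mul_assoc (star (x : A)) y b).symm
  star_inner x y := Subtype.ext (by
    change star (star (x : A) * (y : A)) = star (y : A) * (x : A)
    rw [star_mul, star_star])
  inner_self_nonneg x := by
    -- Positivity is needed inside `A_0`, but `x` lies in `A_1`. Since `E` fixes `x^* x`, its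
    -- positivity supplies a `b` in `A_0` with `x^* x = b^* b`.
    obtain ⟨E, hE, -, hE0, -⟩ := G.exists_expectation
    obtain ⟨b, hb, h⟩ := hE (x : A)
    refine ⟨⟨b, hb⟩, Subtype.ext ?_⟩
    have h0 := hE0 ⟨star (x : A) * (x : A),
      G.mul_mem_of_eq (neg_add_cancel 1) (G.star_mem x.2) x.2⟩
    exact (congrArg Subtype.val h0).symm.trans h
  inner_self_eq_zero x h := Subtype.ext
    (CStarRing.star_mul_self_eq_zero_iff (x : A) |>.1 (congrArg Subtype.val h))
  norm_sq_eq x := by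
    rw [sq]
    exact (CStarRing.norm_star_mul_self (x := (x : A))).symm
  complete := (G.isClosed_component 1).completeSpace_coe
  lact := LinearMap.mk₂ ℂ
    (fun a x => ⟨(a : A) * (x : A), G.mul_mem_of_eq (zero_add 1) a.2 x.2⟩)
    (fun a b x => Subtype.ext (add_mul (a : A) b x))
    (fun c a x => Subtype.ext (smul_mul_assoc c (a : A) (x : A)))
    (fun a x y => Subtype.ext (mul_add (a : A) x y))
    (fun c a x => Subtype.ext (mul_smul_comm c (a : A) (x : A)))
  lact_mul a b x := Subtype.ext (mul_assoc (a : A) b x)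
  inner_lact a x y := Subtype.ext (by
    change star ((a : A) * (x : A)) * (y : A) = star (x : A) * (star (a : A) * (y : A))
    rw [star_mul, mul_assoc])

theorem coe_lact (a : G.zeroSubalgebra) (x : G.component 1) :
    (G.correspondence.lact a x : A) = (a : A) * (x : A) := rfl

theorem coe_ract (x : G.component 1) (a : G.zeroSubalgebra) :
    (G.correspondence.ract x a : A) = (x : A) * (a : A) := rfl

theorem coe_inner (x y : G.component 1) :
    (G.correspondence.inner x y : A) = star (x : A) * (y : A) := rfl

/-- The inclusion of the degree zero part. -/
def subtypeZero : G.zeroSubalgebra →L[ℂ] A where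
  toFun a := a
  map_add' _ _ := rfl
  map_smul' _ _ := rfl
  cont := continuous_subtype_val

variable {G}

/-- In a strong grading, a closed subspace that contains the products `ab` with `a ∈ A_m` and
`b ∈ A_n` contains `A_{m+n}`. -/
theorem IsStrong.component_le (hG : G.IsStrong) {m n k : ℤ} (h : m + n = k) {S : Submodule ℂ A}
    (hS : IsClosed (S : Set A))
    (hmul : ∀ a ∈ G.component m, ∀ b ∈ G.component n, a * b ∈ S) : G.component k ≤ S := by
  rw [← h, ← hG m n]
  refine Submodule.topologicalClosure_minimal _ (Submodule.span_le.2 ?_) hS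
  rintro _ ⟨a, ha, b, hb, rfl⟩
  exact hmul a ha b hb

/-! ### Fullness and compactness of the left action -/

theorem IsStrong.isFull_correspondence (hG : G.IsStrong) : G.correspondence.IsFull := by
  set S := Submodule.span ℂ {b | ∃ x y, G.correspondence.inner x y = b} with hS
  have hcl : IsClosed ((S.topologicalClosure.map G.subtypeZero.toLinearMap : Submodule ℂ A) :
      Set A) := by
    have h : Topology.IsClosedEmbedding (Subtype.val : G.zeroSubalgebra → A) :=
      (G.isClosed_component 0).isClosedEmbedding_subtypeVal
    exact h.isClosedMap _ S.isClosed_topologicalClosure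
  have key : G.component 0 ≤ S.topologicalClosure.map G.subtypeZero.toLinearMap := by
    refine hG.component_le (neg_add_cancel 1) hcl fun a ha b hb => ?_
    -- For `a ∈ A_{-1}` and `b ∈ A_1`, the product `ab` is the inner product of `a^*` and `b`.
    refine ⟨G.correspondence.inner ⟨star a, (G.mem_neg_iff 1 a).1 ha⟩ ⟨b, hb⟩,
      S.le_topologicalClosure (Submodule.subset_span ⟨_, _, rfl⟩), ?_⟩
    change star (star a) * b = a * b
    rw [star_star]
  refine Submodule.eq_top_iff'.2 fun a => ?_
  obtain ⟨b, hb, h⟩ := key a.2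
  rwa [← show b = a from Subtype.ext h]

theorem norm_phi_le (a : G.zeroSubalgebra) : ‖G.correspondence.phi a‖ ≤ ‖a‖ :=
  ContinuousLinearMap.opNorm_le_bound _ (norm_nonneg a) fun x => norm_mul_le (a : A) (x : A)

theorem phi_mul_star (x y : G.component 1) (h : (x : A) * star (y : A) ∈ G.component 0) :
    G.correspondence.phi ⟨(x : A) * star (y : A), h⟩ = G.correspondence.theta x y := by
  ext z
  exact mul_assoc (x : A) (star (y : A)) (z : A)

/-- The left action of `A_0` on `A_1`, as a linear map into the bounded operators. -/
noncomputable def leftAction (G : CStarGrading ℤ A) :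
    G.zeroSubalgebra →L[ℂ] (G.component 1 →L[ℂ] G.component 1) :=
  LinearMap.mkContinuous
    { toFun := fun a => G.correspondence.phi a
      map_add' := fun a b => by ext x; exact add_mul (a : A) b x
      map_smul' := fun c a => by ext x; exact smul_mul_assoc c (a : A) (x : A) } 1
    fun a => by simpa using norm_phi_le a

theorem leftAction_apply (a : G.zeroSubalgebra) : G.leftAction a = G.correspondence.phi a := rfl

/-- The elements of `A_0` acting compactly form a closed subspace, because `φ` is continuous and
`K(X)` is closed. It contains all `xy^*` with `x, y ∈ A_1`, which densely span `A_0`. -/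
theorem IsStrong.hasCompactLeftAction (hG : G.IsStrong) :
    G.correspondence.HasCompactLeftAction := by
  have hcK : IsClosed (G.correspondence.compacts : Set (G.component 1 →L[ℂ] G.component 1)) :=
    Submodule.isClosed_topologicalClosure _
  have hcl : IsClosed ((((G.correspondence.compacts.comap G.leftAction.toLinearMap).map
      G.subtypeZero.toLinearMap : Submodule ℂ A)) : Set A) := by
    have h : Topology.IsClosedEmbedding (Subtype.val : G.zeroSubalgebra → A) :=
      (G.isClosed_component 0).isClosedEmbedding_subtypeVal
    exact h.isClosedMap _ (hcK.preimage G.leftAction.continuous)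
  have key := hG.component_le (add_neg_cancel 1) hcl fun a ha b hb => by
    have hb' := (G.mem_neg_iff 1 b).1 hb
    have hab : a * star (star b) ∈ G.component 0 :=
      G.mul_mem_of_eq (add_neg_cancel 1) ha (G.star_mem hb')
    refine ⟨⟨_, hab⟩, ?_, by simp [subtypeZero]⟩
    change G.correspondence.phi _ ∈ G.correspondence.compacts
    rw [phi_mul_star ⟨a, ha⟩ ⟨star b, hb'⟩]
    exact G.correspondence.theta_mem _ _
  intro a
  obtain ⟨b, hb, h⟩ := key a.2
  rw [← show b = a from Subtype.ext h]
  exact hb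

/-! ### Isometry of the left action -/

theorem norm_mul_le_norm_phi_mul (a : G.zeroSubalgebra) {x : A} (hx : x ∈ G.component 1) :
    ‖(a : A) * x‖ ≤ ‖G.correspondence.phi a‖ * ‖x‖ :=
  (G.correspondence.phi a).le_opNorm ⟨x, hx⟩

/-- For `d` in the span of `A_1 A_{-1}`, the norm of `ad` is at most a multiple of the norm of
`φ(a)`, uniformly in `a ∈ A_0`. -/
theorem exists_bound_of_mem_span (d : A) (hd : d ∈ Submodule.span ℂ
    {c : A | ∃ a ∈ G.component 1, ∃ b ∈ G.component (-1), a * b = c}) :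
    ∃ C : ℝ, ∀ a : G.zeroSubalgebra, ‖(a : A) * d‖ ≤ ‖G.correspondence.phi a‖ * C := by
  induction hd using Submodule.span_induction with
  | mem d hd =>
    obtain ⟨x, hx, y, -, rfl⟩ := hd
    refine ⟨‖x‖ * ‖y‖, fun a => ?_⟩
    rw [← mul_assoc, ← mul_assoc]
    exact (norm_mul_le _ _).trans
      (mul_le_mul_of_nonneg_right (norm_mul_le_norm_phi_mul a hx) (norm_nonneg y))
  | zero => exact ⟨0, by simp⟩
  | add d e _ _ h h' =>
    obtain ⟨C, hC⟩ := h
    obtain ⟨C', hC'⟩ := h'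
    refine ⟨C + C', fun a => ?_⟩
    rw [mul_add, mul_add]
    exact (norm_add_le _ _).trans (add_le_add (hC a) (hC' a))
  | smul c d _ h =>
    obtain ⟨C, hC⟩ := h
    refine ⟨‖c‖ * C, fun a => ?_⟩
    rw [mul_smul_comm, norm_smul, mul_left_comm]
    exact mul_le_mul_of_nonneg_left (hC a) (norm_nonneg c)

theorem phi_mul (a b : G.zeroSubalgebra) :
    G.correspondence.phi (a * b) = (G.correspondence.phi a).comp (G.correspondence.phi b) := by
  ext x
  exact mul_assoc (a : A) b x

/-- The powers `b = a ^ 2 ^ (k + 1)` and `c = a ^ (2 ^ (k + 1) - 1)` of a self-adjoint `a ∈ A_0`,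
with estimates of their norms. -/
theorem exists_pow_two_pow (a : G.zeroSubalgebra) (ha : star a = a) (k : ℕ) :
    ∃ b c : G.zeroSubalgebra, star b = b ∧ a * c = b ∧ ‖b‖ = ‖a‖ ^ 2 ^ (k + 1) ∧
      ‖c‖ * ‖a‖ ≤ ‖a‖ ^ 2 ^ (k + 1) ∧
      ‖G.correspondence.phi b‖ ≤ ‖G.correspondence.phi a‖ ^ 2 ^ (k + 1) := by
  have hphi : ∀ b : G.zeroSubalgebra,
      ‖G.correspondence.phi (b * b)‖ ≤ ‖G.correspondence.phi b‖ ^ 2 := fun b => by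
    rw [phi_mul, sq]
    exact ContinuousLinearMap.opNorm_comp_le _ _
  have hsq : ∀ b : G.zeroSubalgebra, star b = b → ‖b * b‖ = ‖b‖ ^ 2 := fun b hb => by
    have h := CStarRing.norm_star_mul_self (x := b)
    rwa [hb, ← sq] at h
  induction k with
  | zero =>
    -- The exponents start at 2 rather than 1, so that `c` is never the power `a ^ 0`, which need
    -- not exist in `A_0`.
    refine ⟨a * a, a, by rw [star_mul, ha], rfl, ?_, ?_, ?_⟩
    · simpa using hsq a ha
    · simp [sq]
    · simpa using hphi a
  | succ k ih =>
    obtain ⟨b, c, hb, hc, h1, h2, h3⟩ := ih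
    refine ⟨b * b, c * b, by rw [star_mul, hb], by rw [← mul_assoc, hc], ?_, ?_, ?_⟩
    · rw [hsq b hb, h1, ← pow_mul, ← pow_succ]
    · calc ‖c * b‖ * ‖a‖ ≤ ‖c‖ * ‖b‖ * ‖a‖ := by gcongr; exact norm_mul_le c b
        _ = ‖c‖ * ‖a‖ * ‖b‖ := by ring
        _ ≤ ‖a‖ ^ 2 ^ (k + 1) * ‖a‖ ^ 2 ^ (k + 1) := by rw [h1]; gcongr
        _ = ‖a‖ ^ 2 ^ (k + 1 + 1) := by ring
    · refine (hphi b).trans ?_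
      rw [pow_succ 2 (k + 1), pow_mul]
      gcongr

/-- Approximate `a` within `‖a‖ / 2` by some `d` in the span of `A_1 A_{-1}`, so that `‖bd‖ ≤ C
‖φ(b)‖` for all `b ∈ A_0`. With `b = a ^ N` this gives `‖a‖ ^ (N + 1) ≤ ‖a‖ ^ (N + 1) / 2 + |C|
‖φ(a)‖ ^ N`, which fails for large `N` if `‖φ(a)‖ < ‖a‖`. -/
theorem IsStrong.norm_le_norm_phi_of_star_eq (hG : G.IsStrong) (a : G.zeroSubalgebra)
    (ha : star a = a) : ‖a‖ ≤ ‖G.correspondence.phi a‖ := by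
  by_contra! hlt
  have h0 : 0 < ‖a‖ := (norm_nonneg _).trans_lt hlt
  have hmem : (a : A) ∈ closure (Submodule.span ℂ
      {c : A | ∃ a ∈ G.component 1, ∃ b ∈ G.component (-1), a * b = c} : Set A) := by
    rw [← Submodule.topologicalClosure_coe, hG 1 (-1)]
    exact a.2
  obtain ⟨d, hd, hdist⟩ := Metric.mem_closure_iff.1 hmem (‖a‖ / 2) (half_pos h0)
  rw [dist_eq_norm] at hdist
  obtain ⟨C, hC⟩ := exists_bound_of_mem_span d hd
  have hq1 : ‖G.correspondence.phi a‖ / ‖a‖ < 1 := (div_lt_one h0).2 hlt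
  have hq0 : 0 ≤ ‖G.correspondence.phi a‖ / ‖a‖ := by positivity
  obtain ⟨n, hn⟩ := exists_pow_lt_of_lt_one (show 0 < ‖a‖ / 2 / (|C| + 1) by positivity) hq1
  obtain ⟨b, c, hb, hc, h1, h2, h3⟩ := exists_pow_two_pow a ha n
  obtain ⟨N, hN⟩ : ∃ N, N = 2 ^ (n + 1) := ⟨_, rfl⟩
  have hnN : n ≤ N := hN ▸ (Nat.le_succ n).trans (Nat.lt_two_pow_self (n := n + 1)).le
  rw [← hN] at h1 h2 h3
  -- Here `b * b = (b * a) * c`. With `‖c‖ ‖a‖ ≤ ‖b‖` this yields the lower bound for `‖b * a‖`,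
  -- although the exponent `N + 1` is not a power of two.
  have hbb : ‖b‖ ^ 2 ≤ ‖b * a‖ * ‖c‖ := by
    have hb2 : ‖b * b‖ = ‖b‖ ^ 2 := by
      have h := CStarRing.norm_star_mul_self (x := b)
      rwa [hb, ← sq] at h
    rw [← hb2]
    nth_rewrite 2 [← hc]
    rw [← mul_assoc]
    exact norm_mul_le _ _
  have hbpos : 0 < ‖b‖ := by rw [h1]; positivity
  have hba : ‖b‖ * ‖a‖ ≤ ‖b * a‖ := by
    refine le_of_mul_le_mul_right ?_ hbpos
    calc ‖b‖ * ‖a‖ * ‖b‖ = ‖b‖ ^ 2 * ‖a‖ := by ring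
      _ ≤ ‖b * a‖ * ‖c‖ * ‖a‖ := by gcongr
      _ = ‖b * a‖ * (‖c‖ * ‖a‖) := by ring
      _ ≤ ‖b * a‖ * ‖b‖ := by rw [h1]; gcongr
  have hsplit : ‖b * a‖ ≤ ‖b‖ * (‖a‖ / 2) + ‖G.correspondence.phi a‖ ^ N * |C| := by
    have e : (b : A) * (a : A) = (b : A) * ((a : A) - d) + (b : A) * d := by
      rw [← mul_add, sub_add_cancel]
    change ‖(b : A) * (a : A)‖ ≤ _
    rw [e]
    refine (norm_add_le _ _).trans (add_le_add ((norm_mul_le _ _).trans ?_) ((hC b).trans ?_))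
    · exact mul_le_mul_of_nonneg_left hdist.le (norm_nonneg _)
    · calc _ ≤ ‖G.correspondence.phi b‖ * |C| := by gcongr; exact le_abs_self C
        _ ≤ _ := by gcongr
  have hpow : ‖G.correspondence.phi a‖ ^ N ≤ ‖b‖ * (‖G.correspondence.phi a‖ / ‖a‖) ^ n := by
    calc ‖G.correspondence.phi a‖ ^ N = ‖b‖ * (‖G.correspondence.phi a‖ / ‖a‖) ^ N := by
          rw [h1, ← mul_pow, mul_div_cancel₀ _ h0.ne']
      _ ≤ _ := by
          gcongr ?_ * ?_
          exact pow_le_pow_of_le_one hq0 hq1.le hnN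
  rw [lt_div_iff₀ (by positivity)] at hn
  have hfin : ‖b‖ * ‖a‖ ≤ ‖b‖ * (‖a‖ / 2) +
      ‖b‖ * ((‖G.correspondence.phi a‖ / ‖a‖) ^ n * |C|) := by
    refine (hba.trans hsplit).trans ?_
    rw [← mul_assoc]
    gcongr
  rw [← mul_add] at hfin
  have hfin' := le_of_mul_le_mul_left hfin hbpos
  have : 0 ≤ (‖G.correspondence.phi a‖ / ‖a‖) ^ n := by positivity
  rw [mul_add] at hn
  linarith

/-- The left action of `A_0` on `A_1` is isometric if the grading is strong. -/
theorem IsStrong.norm_phi (hG : G.IsStrong) (a : G.zeroSubalgebra) :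
    ‖G.correspondence.phi a‖ = ‖a‖ := by
  refine le_antisymm (norm_phi_le a) ?_
  rcases (norm_nonneg a).eq_or_lt with h | h
  · rw [← h]
    exact norm_nonneg _
  -- The chain is `‖a‖ ^ 2 = ‖a^* a‖ ≤ ‖φ(a^*) φ(a)‖ ≤ ‖a‖ ‖φ(a)‖`. Only contractivity is used at
  -- `a^*`, so no C*-identity for operators on `A_1` enters.
  · refine le_of_mul_le_mul_left ?_ h
    rw [← CStarRing.norm_star_mul_self]
    refine (hG.norm_le_norm_phi_of_star_eq _ (by rw [star_mul, star_star])).trans ?_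
    rw [phi_mul]
    refine (ContinuousLinearMap.opNorm_comp_le _ _).trans ?_
    gcongr
    simpa using norm_phi_le (star a)

theorem IsStrong.hasInjectiveLeftAction (hG : G.IsStrong) :
    G.correspondence.HasInjectiveLeftAction := by
  intro a b h
  have h' : G.leftAction (a - b) = 0 := by
    rw [map_sub, leftAction_apply, leftAction_apply, h, sub_self]
  rw [← sub_eq_zero, ← norm_eq_zero, ← hG.norm_phi, ← leftAction_apply, h', norm_zero]

/-! ### Covariance of the inclusions -/

/-- The representation of `A_1` in `A` given by the inclusions. -/
noncomputable def inclusionRep (G : CStarGrading ℤ A) : G.correspondence.Representation A where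
  π := NonUnitalStarSubalgebraClass.subtype G.zeroSubalgebra
  ψ := (G.component 1).subtype
  map_lact _ _ := rfl
  map_ract _ _ := rfl
  map_inner _ _ := rfl

theorem IsStrong.compacts_le_range (hG : G.IsStrong) :
    G.correspondence.compacts ≤ G.leftAction.range := by
  refine Submodule.topologicalClosure_minimal _ (Submodule.span_le.2 ?_) ?_
  · rintro _ ⟨x, y, rfl⟩
    exact ⟨⟨_, G.mul_mem_of_eq (add_neg_cancel 1) x.2 (G.star_mem y.2)⟩, phi_mul_star x y _⟩
  · have h := AddMonoidHomClass.isometry_of_norm G.leftAction hG.norm_phi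
    exact h.isUniformInducing.isComplete_range.isClosed

/-- The required `σ` is `φ⁻¹` on `K(X)`; injectivity of `φ` makes the chosen preimages linear, and
isometry makes them bounded. -/
theorem IsStrong.inclusionRep_isCovariant (hG : G.IsStrong) : G.inclusionRep.IsCovariant := by
  choose s hs using fun T : G.correspondence.compacts => hG.compacts_le_range T.2
  change ∀ T, G.correspondence.phi (s T) = T at hs
  have hinj := hG.hasInjectiveLeftAction
  refine ⟨⟨⟨fun T => (s T : A), fun S T => ?_⟩, fun c T => ?_⟩, ⟨1, fun T => ?_⟩,
    fun x y => ?_, fun a h => ?_⟩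
  · refine congrArg Subtype.val (hinj (a₁ := s (S + T)) (a₂ := s S + s T) ?_)
    rw [← leftAction_apply (s S + s T), map_add, leftAction_apply, leftAction_apply, hs, hs, hs]
    rfl
  · refine congrArg Subtype.val (hinj (a₁ := s (c • T)) (a₂ := c • s T) ?_)
    rw [← leftAction_apply (c • s T), map_smul, leftAction_apply, hs, hs]
    rfl
  · rw [one_mul]
    change ‖s T‖ ≤ ‖(T : G.component 1 →L[ℂ] G.component 1)‖
    rw [← hs T, hG.norm_phi]
  · refine congrArg Subtype.val (hinj (a₁ := s (G.correspondence.thetaK x y))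
      (a₂ := ⟨_, G.mul_mem_of_eq (add_neg_cancel 1) x.2 (G.star_mem y.2)⟩) ?_)
    rw [hs, phi_mul_star]
    rfl
  · exact congrArg Subtype.val (hinj (hs ⟨_, h⟩))

end CStarGrading

/-! ### Words in the generators of a Cuntz-Pimsner algebra -/

namespace CStarCorrespondence

variable {B : Type u} [NonUnitalCStarAlgebra B]
  {X : Type u} [NormedAddCommGroup X] [NormedSpace ℂ X] (M : CStarCorrespondence B X)

/-- Reduced words of degree `n` in the generators `j_A(a)`, `j_X(x)` and `j_X(x)^*`. -/
inductive IsWord : ℤ → M.BoundedFamilies → Prop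
  | coeff (a : B) : IsWord 0 (M.familyA a)
  | gen (x : X) : IsWord 1 (M.familyX x)
  | gen_mul (x : X) {n : ℤ} {p : M.BoundedFamilies} (hn : 0 < n) (hp : IsWord n p) :
      IsWord (1 + n) (M.familyX x * p)
  | star_gen (x : X) : IsWord (-1) (star (M.familyX x))
  | star_gen_mul (x : X) {n : ℤ} {p : M.BoundedFamilies} (hn : n < 0) (hp : IsWord n p) :
      IsWord (-1 + n) (star (M.familyX x) * p)

variable {M}

theorem familyA_mul (a b : B) : M.familyA (a * b) = M.familyA a * M.familyA b :=
  congrArg Subtype.val (map_mul M.jA a b)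

theorem familyA_star (a : B) : M.familyA (star a) = star (M.familyA a) :=
  congrArg Subtype.val (map_star M.jA a)

theorem familyX_lact (a : B) (x : X) : M.familyX (M.lact a x) = M.familyA a * M.familyX x :=
  congrArg Subtype.val (M.canonicalRep.map_lact a x)

theorem familyX_ract (x : X) (a : B) : M.familyX (M.ract x a) = M.familyX x * M.familyA a :=
  congrArg Subtype.val (M.canonicalRep.map_ract x a)

theorem familyA_inner (x y : X) : M.familyA (M.inner x y) = star (M.familyX x) * M.familyX y :=
  congrArg Subtype.val (M.canonicalRep.map_inner x y)

/-- This is the only consequence of covariance that word reduction needs: it replaces `j_X(x)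
j_X(y)^*` by a coefficient. -/
theorem familyA_eq_of_phi_eq_theta {a : B} {x y : X} (h : M.phi a = M.theta x y) :
    M.familyA a = M.familyX x * star (M.familyX y) := by
  obtain ⟨σ, -, h1, h2⟩ := M.canonicalRep_isCovariant
  have hK : M.phi a ∈ M.compacts := h ▸ M.theta_mem x y
  have e : (⟨M.phi a, hK⟩ : M.compacts) = M.thetaK x y := Subtype.ext h
  exact congrArg Subtype.val ((h2 a hK).symm.trans ((congrArg σ e).trans (h1 x y)))

theorem familyA_mul_star_familyX (a : B) (x : X) :
    M.familyA a * star (M.familyX x) = star (M.familyX (M.ract x (star a))) := by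
  rw [familyX_ract, star_mul, familyA_star, star_star]

theorem star_familyX_mul_familyA (x : X) (a : B) :
    star (M.familyX x) * M.familyA a = star (M.familyX (M.lact (star a) x)) := by
  rw [familyX_lact, star_mul, familyA_star, star_star]

/-! ### Products and adjoints of reduced words -/

namespace IsWord

theorem of_eq {m n : ℤ} {p q : M.BoundedFamilies} (h : M.IsWord m p) (hmn : m = n) (hpq : p = q) :
    M.IsWord n q := hmn ▸ hpq ▸ h

/-- A reduced word never mixes generators with adjoints, so any word that is not a coefficient has
nonzero degree. -/
theorem exists_familyA {p : M.BoundedFamilies} (h : M.IsWord 0 p) : ∃ a, M.familyA a = p := by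
  generalize hn : (0 : ℤ) = n at h
  cases h with
  | coeff a => exact ⟨a, rfl⟩
  | gen x => omega
  | gen_mul x hn hp => omega
  | star_gen x => omega
  | star_gen_mul x hn hp => omega

theorem familyA_mul {n : ℤ} {p : M.BoundedFamilies} (a : B) (h : M.IsWord n p) :
    M.IsWord n (M.familyA a * p) := by
  cases h with
  | coeff b => exact (coeff (a * b)).of_eq rfl (CStarCorrespondence.familyA_mul a b)
  | gen x => exact (gen (M.lact a x)).of_eq rfl (familyX_lact a x)
  | gen_mul x hn hp =>
    exact (gen_mul (M.lact a x) hn hp).of_eq rfl (by rw [familyX_lact, mul_assoc])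
  | star_gen x => exact (star_gen (M.ract x (star a))).of_eq rfl (familyA_mul_star_familyX a x).symm
  | star_gen_mul x hn hp =>
    exact (star_gen_mul (M.ract x (star a)) hn hp).of_eq rfl
      (by rw [← familyA_mul_star_familyX, mul_assoc])

/-- A leading `j_X(y)^*` cancels against `j_X(x)` through `hM` and covariance, and the resulting
coefficient is absorbed into the rest. The opposite cancellation, in `star_familyX_mul`, needs only
the inner product. -/
theorem familyX_mul (hM : ∀ x y, ∃ a, M.phi a = M.theta x y) {n : ℤ} {p : M.BoundedFamilies}
    (x : X) (h : M.IsWord n p) : M.IsWord (1 + n) (M.familyX x * p) := by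
  cases h with
  | coeff b => exact (gen (M.ract x b)).of_eq rfl (familyX_ract x b)
  | gen y => exact gen_mul x one_pos (gen y)
  | gen_mul y hn hp => exact gen_mul x (by omega) (gen_mul y hn hp)
  | star_gen y =>
    obtain ⟨a, ha⟩ := hM x y
    exact (coeff a).of_eq rfl (familyA_eq_of_phi_eq_theta ha)
  | star_gen_mul y hn hp =>
    obtain ⟨a, ha⟩ := hM x y
    exact (hp.familyA_mul a).of_eq (by omega) (by rw [familyA_eq_of_phi_eq_theta ha, mul_assoc])

theorem star_familyX_mul {n : ℤ} {p : M.BoundedFamilies}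
    (x : X) (h : M.IsWord n p) : M.IsWord (-1 + n) (star (M.familyX x) * p) := by
  cases h with
  | coeff b =>
    exact (star_gen (M.lact (star b) x)).of_eq rfl (star_familyX_mul_familyA x b).symm
  | gen y => exact (coeff (M.inner x y)).of_eq rfl (familyA_inner x y)
  | gen_mul y hn hp =>
    exact (hp.familyA_mul (M.inner x y)).of_eq (by omega) (by rw [familyA_inner, mul_assoc])
  | star_gen y => exact star_gen_mul x (by omega) (star_gen y)
  | star_gen_mul y hn hp => exact star_gen_mul x (by omega) (star_gen_mul y hn hp)

theorem mul (hM : ∀ x y, ∃ a, M.phi a = M.theta x y) {m n : ℤ} {p q : M.BoundedFamilies}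
    (hp : M.IsWord m p) (hq : M.IsWord n q) : M.IsWord (m + n) (p * q) := by
  induction hp with
  | coeff a => exact (hq.familyA_mul a).of_eq (by omega) rfl
  | gen x => exact hq.familyX_mul hM x
  | gen_mul x _ _ ih => exact (ih.familyX_mul hM x).of_eq (by omega) (mul_assoc _ _ _).symm
  | star_gen x => exact hq.star_familyX_mul x
  | star_gen_mul x _ _ ih => exact (ih.star_familyX_mul x).of_eq (by omega) (mul_assoc _ _ _).symm

theorem star (hM : ∀ x y, ∃ a, M.phi a = M.theta x y) {n : ℤ} {p : M.BoundedFamilies}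
    (hp : M.IsWord n p) : M.IsWord (-n) (star p) := by
  induction hp with
  | coeff a => exact (coeff (Star.star a)).of_eq rfl (familyA_star a)
  | gen x => exact star_gen x
  | gen_mul x _ _ ih => exact (ih.mul hM (star_gen x)).of_eq (by omega) (star_mul _ _).symm
  | star_gen x => exact (gen x).of_eq (by omega) (star_star _).symm
  | star_gen_mul x _ _ ih =>
    exact (ih.mul hM (gen x)).of_eq (by omega) (by rw [star_mul, star_star])

end IsWord

/-! ### Decomposition of the generated *-algebra by degree -/

variable (M) in
/-- The linear span of the words of degree `n`. -/
noncomputable def wordSpan (n : ℤ) : Submodule ℂ M.BoundedFamilies :=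
  Submodule.span ℂ {p | M.IsWord n p}

theorem mul_mem_wordSpan (hM : ∀ x y, ∃ a, M.phi a = M.theta x y) {m n : ℤ}
    {p q : M.BoundedFamilies} (hp : p ∈ M.wordSpan m) (hq : q ∈ M.wordSpan n) :
    p * q ∈ M.wordSpan (m + n) := by
  induction hp using Submodule.span_induction with
  | mem p hp =>
    induction hq using Submodule.span_induction with
    | mem q hq => exact Submodule.subset_span (hp.mul hM hq)
    | zero => rw [mul_zero]; exact zero_mem _
    | add q q' _ _ h h' => rw [mul_add]; exact add_mem h h'
    | smul c q _ h => rw [mul_smul_comm]; exact Submodule.smul_mem _ c h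
  | zero => rw [zero_mul]; exact zero_mem _
  | add p p' _ _ h h' => rw [add_mul]; exact add_mem h h'
  | smul c p _ h => rw [smul_mul_assoc]; exact Submodule.smul_mem _ c h

theorem star_mem_wordSpan (hM : ∀ x y, ∃ a, M.phi a = M.theta x y) {n : ℤ}
    {p : M.BoundedFamilies} (hp : p ∈ M.wordSpan n) : star p ∈ M.wordSpan (-n) := by
  induction hp using Submodule.span_induction with
  | mem p hp => exact Submodule.subset_span (hp.star hM)
  | zero => rw [star_zero]; exact zero_mem _
  | add p p' _ _ h h' => rw [star_add]; exact add_mem h h'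
  | smul c p _ h => rw [star_smul]; exact Submodule.smul_mem _ _ h

theorem exists_familyA_of_mem_wordSpan {p : M.BoundedFamilies} (hp : p ∈ M.wordSpan 0) :
    ∃ a, M.familyA a = p := by
  induction hp using Submodule.span_induction with
  | mem p hp => exact hp.exists_familyA
  | zero => exact ⟨0, congrArg Subtype.val (map_zero M.jA)⟩
  | add p p' _ _ h h' =>
    obtain ⟨a, rfl⟩ := h
    obtain ⟨b, rfl⟩ := h'
    exact ⟨a + b, congrArg Subtype.val (map_add M.jA a b)⟩
  | smul c p _ h =>
    obtain ⟨a, rfl⟩ := h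
    exact ⟨c • a, congrArg Subtype.val (map_smul M.jA c a)⟩

variable (M) in
/-- The *-subalgebra generated by the families of generators. -/
noncomputable abbrev generated : NonUnitalStarSubalgebra ℂ M.BoundedFamilies :=
  NonUnitalStarAlgebra.adjoin ℂ (Set.range M.familyA ∪ Set.range M.familyX)

theorem mem_iSup_wordSpan (hM : ∀ x y, ∃ a, M.phi a = M.theta x y) {f : M.BoundedFamilies}
    (hf : f ∈ M.generated) : f ∈ ⨆ n, M.wordSpan n := by
  have hle : ∀ {n p}, M.IsWord n p → p ∈ ⨆ n, M.wordSpan n := fun {n p} h =>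
    Submodule.mem_iSup_of_mem n (Submodule.subset_span h)
  induction hf using NonUnitalStarAlgebra.adjoin_induction with
  | mem f hf =>
    rcases hf with ⟨a, rfl⟩ | ⟨x, rfl⟩
    · exact hle (.coeff a)
    · exact hle (.gen x)
  | zero => exact zero_mem _
  | add f g _ _ h h' => exact add_mem h h'
  | smul c f _ h => exact Submodule.smul_mem _ c h
  | mul f g hf' hg' hf hg =>
    clear hf' hg'
    induction hf using Submodule.iSup_induction' with
    | mem m p hp =>
      induction hg using Submodule.iSup_induction' with
      | mem n q hq => exact Submodule.mem_iSup_of_mem _ (mul_mem_wordSpan hM hp hq)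
      | zero => rw [mul_zero]; exact zero_mem _
      | add q q' _ _ h h' => rw [mul_add]; exact add_mem h h'
    | zero => rw [zero_mul]; exact zero_mem _
    | add p p' _ _ h h' => rw [add_mul]; exact add_mem h h'
  | star f hf' hf =>
    clear hf'
    induction hf using Submodule.iSup_induction' with
    | mem m p hp => exact Submodule.mem_iSup_of_mem _ (star_mem_wordSpan hM hp)
    | zero => rw [star_zero]; exact zero_mem _
    | add p p' _ _ h h' => rw [star_add]; exact add_mem h h'

/-! ### Evaluation at a covariant representation -/

namespace CovariantRep

/-- Evaluation of a family at a covariant representation. -/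
noncomputable def eval (ρ : M.CovariantRep) : M.BoundedFamilies →⋆ₙₐ[ℂ] ρ.carrier where
  toFun f := f ρ
  map_smul' _ _ := rfl
  map_zero' := rfl
  map_add' _ _ := rfl
  map_mul' _ _ := rfl
  map_star' _ := rfl

theorem eval_familyA (ρ : M.CovariantRep) (a : B) : ρ.eval (M.familyA a) = ρ.rep.π a := rfl

theorem eval_familyX (ρ : M.CovariantRep) (x : X) : ρ.eval (M.familyX x) = ρ.rep.ψ x := rfl

theorem norm_eval_le (ρ : M.CovariantRep) (f : M.BoundedFamilies) : ‖ρ.eval f‖ ≤ ‖f‖ :=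
  lp.norm_apply_le_norm ENNReal.top_ne_zero f ρ

/-- An evaluation that is isometric on the coefficient algebra is isometric on words of a given
degree. -/
theorem norm_le_norm_eval (hM : ∀ x y, ∃ a, M.phi a = M.theta x y) (ρ : M.CovariantRep)
    (hρ : ∀ a, ‖a‖ ≤ ‖ρ.rep.π a‖) {n : ℤ} {p : M.BoundedFamilies} (hp : p ∈ M.wordSpan n) :
    ‖p‖ ≤ ‖ρ.eval p‖ := by
  -- The element `p^* p` has degree 0, hence is a coefficient, and the C*-identity transfers the
  -- bound on coefficients to `p`.
  have h := mul_mem_wordSpan hM (star_mem_wordSpan hM hp) hp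
  rw [neg_add_cancel] at h
  obtain ⟨a, ha⟩ := exists_familyA_of_mem_wordSpan h
  refine le_of_sq_le_sq ?_ (norm_nonneg _)
  rw [sq, sq, ← CStarRing.norm_star_mul_self, ← CStarRing.norm_star_mul_self, ← map_star,
    ← map_mul, ← ha, eval_familyA]
  exact (NonUnitalStarAlgHom.norm_apply_le M.jA a).trans (hρ a)

/-! ### Gauge twists of a representation -/

/-- The covariant representation `(π, zψ)` for a covariant representation `(π, ψ)`. -/
noncomputable def twist (ρ : M.CovariantRep) (z : Circle) : M.CovariantRep where
  carrier := ρ.carrier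
  rep :=
    { π := ρ.rep.π
      ψ := (z : ℂ) • ρ.rep.ψ
      map_lact := fun a x => by
        rw [LinearMap.smul_apply, LinearMap.smul_apply, ρ.rep.map_lact, mul_smul_comm]
      map_ract := fun a x => by
        rw [LinearMap.smul_apply, LinearMap.smul_apply, ρ.rep.map_ract, smul_mul_assoc]
      map_inner := fun x y => by
        rw [LinearMap.smul_apply, LinearMap.smul_apply, ρ.rep.map_inner, star_smul,
          smul_mul_smul_comm, Complex.star_def, Complex.conj_mul', Circle.norm_coe]
        simp }
  covariant := by
    obtain ⟨σ, h1, h2, h3⟩ := ρ.covariant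
    -- The same `σ` serves, since `z` times its conjugate is 1.
    refine ⟨σ, h1, fun x y => ?_, h3⟩
    rw [h2, LinearMap.smul_apply, LinearMap.smul_apply, star_smul,
          smul_mul_smul_comm, Complex.star_def, Complex.mul_conj', Circle.norm_coe]
    simp

/-- Evaluation at `(π, zψ)`. -/
noncomputable def evalTwist (ρ : M.CovariantRep) (z : Circle) :
    M.BoundedFamilies →⋆ₙₐ[ℂ] ρ.carrier :=
  (ρ.twist z).eval

theorem evalTwist_familyA (ρ : M.CovariantRep) (z : Circle) (a : B) :
    ρ.evalTwist z (M.familyA a) = ρ.rep.π a := rfl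

theorem evalTwist_familyX (ρ : M.CovariantRep) (z : Circle) (x : X) :
    ρ.evalTwist z (M.familyX x) = (z : ℂ) • ρ.rep.ψ x := rfl

theorem norm_evalTwist_le (ρ : M.CovariantRep) (z : Circle) (f : M.BoundedFamilies) :
    ‖ρ.evalTwist z f‖ ≤ ‖f‖ :=
  (ρ.twist z).norm_eval_le f

theorem evalTwist_word (ρ : M.CovariantRep) (z : Circle) {n : ℤ} {p : M.BoundedFamilies}
    (hp : M.IsWord n p) : ρ.evalTwist z p = ((z ^ n : Circle) : ℂ) • ρ.eval p := by
  induction hp with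
  | coeff a => simp [evalTwist_familyA, eval_familyA]
  | gen x => simp [evalTwist_familyX, eval_familyX]
  | gen_mul x _ _ ih =>
    rw [map_mul, map_mul, ih, evalTwist_familyX, eval_familyX, smul_mul_smul_comm, zpow_one_add,
      Circle.coe_mul]
  | star_gen x =>
    rw [map_star, map_star, evalTwist_familyX, eval_familyX, star_smul, zpow_neg_one,
      Circle.coe_inv_eq_conj, Complex.star_def]
  | star_gen_mul x _ _ ih =>
    rw [map_mul, map_mul, ih, map_star, map_star, evalTwist_familyX, eval_familyX, star_smul,
      smul_mul_smul_comm, zpow_add, zpow_neg_one, Circle.coe_mul, Circle.coe_inv_eq_conj,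
      Complex.star_def]

theorem evalTwist_of_mem_wordSpan (ρ : M.CovariantRep) (z : Circle) {n : ℤ}
    {p : M.BoundedFamilies} (hp : p ∈ M.wordSpan n) :
    ρ.evalTwist z p = ((z ^ n : Circle) : ℂ) • ρ.eval p := by
  induction hp using Submodule.span_induction with
  | mem p hp => exact ρ.evalTwist_word z hp
  | zero => rw [map_zero, map_zero, smul_zero]
  | add p q _ _ h h' => rw [map_add, map_add, h, h', smul_add]
  | smul c p _ h => rw [map_smul, map_smul, h, smul_comm]

end CovariantRep

end CStarCorrespondence

/-! ### The gauge-invariant uniqueness argument -/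

theorem norm_fourierCoeff_le (u : C(AddCircle (1 : ℝ), ℂ)) (n : ℤ) : ‖fourierCoeff u n‖ ≤ ‖u‖ := by
  unfold fourierCoeff
  refine (MeasureTheory.norm_integral_le_of_norm_le_const (C := ‖u‖)
    (Filter.Eventually.of_forall fun t => ?_)).trans (by simp)
  rw [norm_smul, fourier_apply, Circle.norm_coe, one_mul]
  exact u.norm_coe_le_norm t

theorem integrable_addCircle (u : C(AddCircle (1 : ℝ), ℂ)) :
    MeasureTheory.Integrable u AddCircle.haarAddCircle :=
  u.continuous.integrable_of_hasCompactSupport (HasCompactSupport.of_compactSpace _)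

theorem fourierCoeff_add (u v : C(AddCircle (1 : ℝ), ℂ)) (n : ℤ) :
    fourierCoeff (u + v : C(AddCircle (1 : ℝ), ℂ)) n = fourierCoeff u n + fourierCoeff v n := by
  rw [ContinuousMap.coe_add, fourierCoeff.add (integrable_addCircle u) (integrable_addCircle v)]
  rfl

/-- A continuous function on the circle whose Fourier coefficients vanish is zero. -/
theorem eq_zero_of_fourierCoeff_eq_zero {u : C(AddCircle (1 : ℝ), ℂ)}
    (h : ∀ n, fourierCoeff u n = 0) : u = 0 := by
  have h0 : fourierCoeff u = 0 := funext h
  have hs := hasSum_fourier_series_of_summable (f := u) (by rw [h0]; exact summable_zero)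
  have hz : (fun i => fourierCoeff u i • fourier i) = fun _ => (0 : C(AddCircle (1 : ℝ), ℂ)) := by
    ext i t
    simp [h]
  rw [hz] at hs
  exact hs.unique hasSum_zero

theorem fourierCoeff_trigonometric (s : Finset ℤ) (c : ℤ → ℂ) (n : ℤ) :
    fourierCoeff (∑ m ∈ s, c m • fourier m : C(AddCircle (1 : ℝ), ℂ)) n =
      if n ∈ s then c n else 0 := by
  have h : ((∑ m ∈ s, c m • fourier m : C(AddCircle (1 : ℝ), ℂ)) : AddCircle (1 : ℝ) → ℂ) =
      ∑ m ∈ s, c m • (fourier m : AddCircle (1 : ℝ) → ℂ) := by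
    ext t
    simp
  rw [h, fourierCoeff.sum _ _ fun m _ => (integrable_addCircle (fourier m)).smul (c m)]
  simp [fourierCoeff.const_smul, fourierCoeff_fourier, Pi.single_apply]

namespace CStarCorrespondence

variable {B : Type u} [NonUnitalCStarAlgebra B]
  {X : Type u} [NormedAddCommGroup X] [NormedSpace ℂ X] {M : CStarCorrespondence B X}

namespace CovariantRep

/-- The twist by 1 is a different index of the family until `1 • ψ` is identified with `ψ`. The
carriers already agree, so equality of the representations suffices. -/
theorem evalTwist_one (ρ : M.CovariantRep) (f : M.BoundedFamilies) :
    ρ.evalTwist 1 f = ρ.eval f := by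
  obtain ⟨C, r, hr⟩ := ρ
  have h : ∀ (r' : M.Representation C) (hr' : r'.IsCovariant), r' = r →
      (f ⟨C, r', hr'⟩ : C) = f ⟨C, r, hr⟩ := by
    rintro _ _ rfl
    rfl
  refine h _ _ ?_
  cases r
  simp

/-- The norm of the homogeneous parts of a sum of words is controlled by the evaluation at `ρ`. -/
def BoundsDegrees (ρ : M.CovariantRep) : Prop :=
  ∀ d : ℤ →₀ M.BoundedFamilies, (∀ n, d n ∈ M.wordSpan n) →
    ∀ n, ‖d n‖ ≤ ‖ρ.eval (d.sum fun _ p => p)‖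

/-- Decomposing `f` into homogeneous parts makes the function a trigonometric polynomial, whose
`n`-th coefficient is `l` of the value of the degree `n` part at `ρ`. -/
theorem exists_gauge_generated (hM : ∀ x y, ∃ a, M.phi a = M.theta x y) {ρ₀ : M.CovariantRep}
    (h₀ : ρ₀.BoundsDegrees) (ρ : M.CovariantRep) (l : ρ.carrier →L[ℂ] ℂ) {f : M.BoundedFamilies}
    (hf : f ∈ M.generated) :
    ∃ u : C(AddCircle (1 : ℝ), ℂ), (∀ t, u t = l (ρ.evalTwist t.toCircle f)) ∧
      ∀ n, ‖fourierCoeff u n‖ ≤ ‖l‖ * ‖ρ₀.eval f‖ := by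
  obtain ⟨d, hd, rfl⟩ := (Submodule.mem_iSup_iff_exists_finsupp _ _).1 (mem_iSup_wordSpan hM hf)
  refine ⟨∑ m ∈ d.support, l (ρ.eval (d m)) • fourier m, fun t => ?_, fun n => ?_⟩
  · rw [Finsupp.sum, map_sum, map_sum, ContinuousMap.sum_apply]
    refine Finset.sum_congr rfl fun m _ => ?_
    rw [ρ.evalTwist_of_mem_wordSpan _ (hd m), map_smul, ← AddCircle.toCircle_zsmul,
      ContinuousMap.smul_apply, fourier_apply, smul_eq_mul, smul_eq_mul, mul_comm]
  · rw [fourierCoeff_trigonometric]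
    split_ifs
    · refine (l.le_opNorm _).trans (mul_le_mul_of_nonneg_left ?_ (norm_nonneg l))
      exact (ρ.norm_eval_le _).trans (h₀ d hd n)
    · rw [norm_zero]
      positivity

theorem eq_zero_of_eval_eq_zero (hM : ∀ x y, ∃ a, M.phi a = M.theta x y) {ρ₀ : M.CovariantRep}
    (h₀ : ρ₀.BoundsDegrees) {f : M.BoundedFamilies} (hf : f ∈ M.cuntzPimsner)
    (hf0 : ρ₀.eval f = 0) : f = 0 := by
  have happrox : ∀ ε > 0, ∃ g ∈ M.generated, ‖f - g‖ < ε := fun ε hε => by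
    obtain ⟨g, hg, h⟩ := Metric.mem_closure_iff.1 (show f ∈ closure (M.generated : Set _) from hf)
      ε hε
    exact ⟨g, hg, by rwa [← dist_eq_norm]⟩
  refine Subtype.ext (funext fun ρ => ?_)
  change ρ.eval f = 0
  -- Functionals reduce the argument to scalar Fourier series.
  refine SeparatingDual.eq_zero_of_forall_dual_eq_zero (R := ℂ) fun l => ?_
  have hbound : ∀ (g : M.BoundedFamilies) (z : Circle),
      ‖l (ρ.evalTwist z f) - l (ρ.evalTwist z g)‖ ≤ ‖l‖ * ‖f - g‖ := fun g z => by
    rw [← map_sub, ← map_sub]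
    exact (l.le_opNorm _).trans
      (mul_le_mul_of_nonneg_left (ρ.norm_evalTwist_le z _) (norm_nonneg l))
  -- By `hbound` the function is a uniform limit of trigonometric polynomials.
  have hcont : Continuous fun t : AddCircle (1 : ℝ) => l (ρ.evalTwist t.toCircle f) := by
    refine continuous_of_uniform_approx_of_continuous fun U hU => ?_
    obtain ⟨ε, hε, hεU⟩ := Metric.mem_uniformity_dist.1 hU
    obtain ⟨g, hg, hfg⟩ := happrox (ε / (‖l‖ + 1)) (by positivity)
    obtain ⟨u, hu, -⟩ := exists_gauge_generated hM h₀ ρ l hg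
    refine ⟨u, u.continuous, fun t => hεU ?_⟩
    rw [dist_eq_norm, hu]
    refine (hbound g _).trans_lt ?_
    rw [lt_div_iff₀ (by positivity)] at hfg
    nlinarith [norm_nonneg (f - g)]
  let u : C(AddCircle (1 : ℝ), ℂ) := ⟨_, hcont⟩
  have hu : u = 0 := by
    refine eq_zero_of_fourierCoeff_eq_zero fun n => norm_le_zero_iff.1 ?_
    refine le_of_forall_pos_le_add fun ε hε => ?_
    -- The coefficients of `u - v` and of `v` are each at most `‖l‖ ‖f - g‖`, the latter because `f`
    -- evaluates to 0 at `ρ₀`; this accounts for the factor 2. Adding 1 covers `l = 0`.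
    obtain ⟨g, hg, hfg⟩ := happrox (ε / (2 * (‖l‖ + 1))) (by positivity)
    obtain ⟨v, hv, hvn⟩ := exists_gauge_generated hM h₀ ρ l hg
    have huv : ‖u - v‖ ≤ ‖l‖ * ‖f - g‖ := by
      refine (ContinuousMap.norm_le _ (by positivity)).2 fun t => ?_
      rw [ContinuousMap.sub_apply, hv]
      exact hbound g _
    have hg0 : ‖ρ₀.eval g‖ ≤ ‖f - g‖ := by
      have := ρ₀.norm_eval_le (f - g)
      rwa [map_sub, hf0, zero_sub, norm_neg] at this
    have hsplit : fourierCoeff u n = fourierCoeff (u - v : C(AddCircle (1 : ℝ), ℂ)) n +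
        fourierCoeff v n := by
      rw [← fourierCoeff_add, sub_add_cancel]
    rw [hsplit, zero_add]
    rw [lt_div_iff₀ (by positivity)] at hfg
    have h1 := (norm_fourierCoeff_le (u - v) n).trans huv
    have h2 := (hvn n).trans (mul_le_mul_of_nonneg_left hg0 (norm_nonneg l))
    refine (norm_add_le _ _).trans ((add_le_add h1 h2).trans ?_)
    nlinarith [norm_nonneg (f - g)]
  have h1 : u 0 = 0 := by rw [hu]; rfl
  have h2 : u 0 = l (ρ.evalTwist 1 f) := by
    change l (ρ.evalTwist (AddCircle.toCircle 0) f) = _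
    rw [AddCircle.toCircle_zero]
  rw [← ρ.evalTwist_one, ← h2, h1]

end CovariantRep

end CStarCorrespondence

/-! ### The isomorphism between `O_X` and `A` -/

namespace CStarGrading

variable {A : Type u} [NonUnitalCStarAlgebra A] {G : CStarGrading ℤ A}

theorem exists_phi_eq_theta (x y : G.component 1) :
    ∃ a, G.correspondence.phi a = G.correspondence.theta x y :=
  ⟨_, phi_mul_star x y (G.mul_mem_of_eq (add_neg_cancel 1) x.2 (G.star_mem y.2))⟩

/-- The inclusions of `A_0` and `A_1`, as a covariant representation. -/
noncomputable def IsStrong.covariantRep (hG : G.IsStrong) : G.correspondence.CovariantRep :=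
  ⟨A, G.inclusionRep, hG.inclusionRep_isCovariant⟩

/-- Evaluation at the representation of `A_1` in `A` given by the inclusions. -/
noncomputable def IsStrong.toAlgebra (hG : G.IsStrong) :
    G.correspondence.BoundedFamilies →⋆ₙₐ[ℂ] A :=
  hG.covariantRep.eval

theorem IsStrong.toAlgebra_mem_of_isWord (hG : G.IsStrong) {n : ℤ}
    {p : G.correspondence.BoundedFamilies} (hp : G.correspondence.IsWord n p) :
    hG.toAlgebra p ∈ G.component n := by
  induction hp with
  | coeff a => exact a.2
  | gen x => exact x.2
  | gen_mul x _ _ ih => rw [map_mul]; exact G.mul_mem x.2 ih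
  | star_gen x => rw [map_star]; exact G.star_mem x.2
  | star_gen_mul x _ _ ih => rw [map_mul, map_star]; exact G.mul_mem (G.star_mem x.2) ih

theorem IsStrong.toAlgebra_mem (hG : G.IsStrong) {n : ℤ}
    {p : G.correspondence.BoundedFamilies} (hp : p ∈ G.correspondence.wordSpan n) :
    hG.toAlgebra p ∈ G.component n := by
  induction hp using Submodule.span_induction with
  | mem p hp => exact hG.toAlgebra_mem_of_isWord hp
  | zero => rw [map_zero]; exact zero_mem _
  | add p q _ _ h h' => rw [map_add]; exact add_mem h h'
  | smul c p _ h => rw [map_smul]; exact Submodule.smul_mem _ c h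

/-- The norm of `d n` is at most that of its image in `A`, as evaluation is isometric on `A_0`; that
image is a homogeneous component of the total, so `norm_component_le` applies. -/
theorem IsStrong.boundsDegrees (hG : G.IsStrong) : hG.covariantRep.BoundsDegrees := by
  intro d hd n
  by_cases hn : n ∈ d.support
  · refine (hG.covariantRep.norm_le_norm_eval exists_phi_eq_theta (fun a => le_rfl) (hd n)).trans ?_
    have h := G.norm_component_le d.support (fun m => hG.toAlgebra (d m))
      (fun m => hG.toAlgebra_mem (hd m)) hn
    rw [← map_sum] at h
    exact h
  · rw [Finsupp.notMem_support_iff.1 hn, norm_zero]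
    exact norm_nonneg _

/-- The homomorphism from the Cuntz-Pimsner algebra of `A_1` to `A` induced by the inclusions. -/
noncomputable def IsStrong.ofCuntzPimsner (hG : G.IsStrong) :
    G.correspondence.CuntzPimsner →⋆ₙₐ[ℂ] A :=
  hG.toAlgebra.comp (NonUnitalStarSubalgebraClass.subtype G.correspondence.cuntzPimsner)

theorem IsStrong.ofCuntzPimsner_injective (hG : G.IsStrong) :
    Function.Injective hG.ofCuntzPimsner := by
  refine (injective_iff_map_eq_zero _).2 fun f hf => Subtype.ext ?_
  exact CStarCorrespondence.CovariantRep.eq_zero_of_eval_eq_zero exists_phi_eq_theta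
    hG.boundsDegrees f.2 hf

theorem IsStrong.ofCuntzPimsner_surjective (hG : G.IsStrong) :
    Function.Surjective hG.ofCuntzPimsner := by
  let S : Submodule ℂ A :=
    LinearMap.range (hG.ofCuntzPimsner : G.correspondence.CuntzPimsner →ₗ[ℂ] A)
  have hS : ∀ {a}, a ∈ S ↔ ∃ f, hG.ofCuntzPimsner f = a := Iff.rfl
  have hmul : ∀ {a b}, a ∈ S → b ∈ S → a * b ∈ S := by
    rintro _ _ ⟨f, rfl⟩ ⟨g, rfl⟩
    exact ⟨f * g, map_mul hG.ofCuntzPimsner f g⟩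
  have hstar : ∀ {a}, a ∈ S → star a ∈ S := by
    rintro _ ⟨f, rfl⟩
    exact ⟨star f, map_star hG.ofCuntzPimsner f⟩
  have hcl : IsClosed (S : Set A) :=
    (NonUnitalStarAlgHom.isometry hG.ofCuntzPimsner
      hG.ofCuntzPimsner_injective).isUniformInducing.isComplete_range.isClosed
  have hnat : ∀ n : ℕ, G.component n ≤ S := by
    intro n
    induction n with
    | zero => exact fun a ha => ⟨G.correspondence.jA ⟨a, ha⟩, rfl⟩
    | succ n ih =>
      -- Strength enters as density of the span of `A_n A_1` in `A_{n+1}`; negative degrees then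
      -- follow by taking adjoints.
      refine hG.component_le (Nat.cast_succ n).symm hcl fun a ha b hb => hmul (ih ha) ?_
      exact ⟨G.correspondence.jX ⟨b, hb⟩, rfl⟩
  have hint : ∀ n : ℤ, G.component n ≤ S := by
    intro n
    obtain ⟨k, rfl | rfl⟩ := n.eq_nat_or_neg
    · exact hnat k
    · intro a ha
      have := hstar (hnat k ((G.mem_neg_iff k a).1 ha))
      rwa [star_star] at this
  have htop : (⊤ : Submodule ℂ A) ≤ S := by
    rw [← G.dense_span]
    exact Submodule.topologicalClosure_minimal _ (iSup_le hint) hcl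
  exact fun a => htop (Submodule.mem_top (x := a))

end CStarGrading

theorem mainTheorem3 {A : Type u} [NonUnitalCStarAlgebra A] (G : CStarGrading ℤ A)
    (hG : G.IsStrong) :
    ∃ X : CStarCorrespondence G.zeroSubalgebra (G.component 1),
      (∀ (a : G.zeroSubalgebra) (x : G.component 1), (X.lact a x : A) = (a : A) * (x : A)) ∧
      (∀ (x : G.component 1) (a : G.zeroSubalgebra), (X.ract x a : A) = (x : A) * (a : A)) ∧
      (∀ x y : G.component 1, (X.inner x y : A) = star (x : A) * (y : A)) ∧
      X.IsFull ∧ X.HasCompactLeftAction ∧ X.HasInjectiveLeftAction ∧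
      ∃ Ψ : A ≃⋆ₐ[ℂ] X.CuntzPimsner,
        (∀ x : G.component 1, Ψ (x : A) = X.jX x) ∧
        (∀ a : G.zeroSubalgebra, Ψ (a : A) = X.jA a) := by
  let e := StarAlgEquiv.ofBijective hG.ofCuntzPimsner
    ⟨hG.ofCuntzPimsner_injective, hG.ofCuntzPimsner_surjective⟩
  exact ⟨G.correspondence, G.coe_lact, G.coe_ract, G.coe_inner, hG.isFull_correspondence,
    hG.hasCompactLeftAction, hG.hasInjectiveLeftAction, e.symm,
    -- Evaluation at the inclusions sends `j_X(x)` to `x` by definition, so inverting it at `j_X(x)`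
    -- is the claim.
    fun x => e.symm_apply_apply (G.correspondence.jX x),
    fun a => e.symm_apply_apply (G.correspondence.jA a)⟩
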